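/- Let $\mu$ be the Gauss measure on $I=(0,1]$, i.e. $\mu(B)=\frac{1}{\log 2}\int_B\frac{dx}{1+x}$ for Borel sets $B\subseteq I$. For $x\in I$ let $a(x)=\lfloor 1/x\rfloor$ be the first continued fraction digit of $x$, and let $a'(x)=a(x)$ if $a(x)$ is a prime number and $a'(x)=0$ otherwise. Below, $\log$ is the natural logarithm, $f\sim g$ means $f/g\to1$, and all asymptotics hold as the real variable $K$, respectively $N$, tends to $\infty$. 1. (Tail behaviour) $$\mu(\{a'\ge K\})\sim\frac{1}{\log 2}\cdot\frac{1}{K\log K}\quad(K\to\infty).$$ 2. $a'$ is not integrable: $\int_I a'\,d\mu=\infty$. 3. (Truncated expectation) $$L'(N):=\int_I\min(a',N)\,d\mu\sim\frac{\log\log N}{\log 2}\quad(N\to\infty).$$ 4. Consequently $$\alpha(N):=\frac{N}{L'(N)}\sim\log 2\cdot\frac{N}{\log\log N}\quad(N\to\infty),$$ and $\alpha$ is asymptotically inverse to $\beta(N):=\frac{N\log\log N}{\log 2}$, i.e. $\alpha(N)\to\infty$, $\beta(N)\to\infty$, $\alpha(\beta(N))\sim N$ and $\beta(\alpha(N))\sim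 N$ as $N\to\infty$. -/

import Mathlib

open Filter Asymptotics MeasureTheory

namespace PrimeDigit

/-- The Gauss measure, carried by the interval `(0, 1]`: the measure with Lebesgue density
`x ↦ 1 / (log 2 * (1 + x))` there. -/
noncomputable def gaussMeasure : Measure ℝ :=
  (volume.restrict (Set.Ioc (0 : ℝ) 1)).withDensity
    fun x => ENNReal.ofReal (1 / (Real.log 2 * (1 + x)))

/-- The (first) continued fraction digit `⌊1 / x⌋` of `x ∈ (0, 1]`. -/
noncomputable def digit (x : ℝ) : ℕ := ⌊1 / x⌋₊

/-- The restricted (prime) digit: the first continued fraction digit of `x` if that digit is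
a prime number, and `0` otherwise. -/
noncomputable def primeDigit (x : ℝ) : ℕ := if (digit x).Prime then digit x else 0

/-- The truncated expectation `L'(t)` of the prime digit, for a real truncation level `t`. -/
noncomputable def truncatedMean (t : ℝ) : ℝ :=
  ∫ x, min (primeDigit x : ℝ) t ∂gaussMeasure

/-- The function `a'(t) = t / L'(t)`. -/
noncomputable def aPrime (t : ℝ) : ℝ := t / truncatedMean t

/-- The function `b'(t) = t * log (log t) / log 2`. -/
noncomputable def bPrime (t : ℝ) : ℝ := t * Real.log (Real.log t) / Real.log 2

/-- Two real functions (considered near `∞`) are asymptotically inverse to each other: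
both tend to `∞`, and both compositions are asymptotically equivalent to the identity. -/
def AsymptoticallyInverse (f g : ℝ → ℝ) : Prop :=
  Tendsto f atTop atTop ∧ Tendsto g atTop atTop ∧
    (fun t => f (g t)) ~[atTop] (fun t => t) ∧ (fun t => g (f t)) ~[atTop] (fun t => t)

end PrimeDigit

/-! The digit equals `n` on `(1/(n+1), 1/n]`, whose Gauss measure lies between `1/(log 2 · (n+1)²)`
and `1/(log 2 · n²)`. The tail of the prime digit beyond `K` is therefore asymptotic to `1/log 2`
times the sum of `1/p²` over primes `p > K`. By the prime number theorem and Abel summation that sum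
is asymptotic to `1/(K log K)` (`eventually_sum_inv_sq_le`, `eventually_le_sum_inv_sq`). By the
layer-cake formula the truncated mean is the integral of the tail up to `N`, and `1/(t log t)` is
the derivative of `log log t`. This gives the truncated mean, hence non-integrability. The inverse
relation holds because `log log` does not notice, up to equivalence, a factor `log log t` in its
argument.

The prime number theorem is proved here, by a Wiener–Ikehara argument (`tendsto_one_of_laplace`)
applied to `ψ(e^t) e^(-t)`. Boundedness of this function is Chebyshev's estimate; the regularity of
its Laplace transform up to the imaginary axis is the continuity of `-ζ'/ζ`, less its pole, on `Re s
≥ 1`, taken from the modulus one case of Dirichlet's theorem. -/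

namespace PrimeDigit

open Topology Set

/-! ### The Fejér kernel: a nonnegative integrable kernel with compactly supported transform -/

/-- The Fejér kernel, up to normalization: the cosine transform of the triangle function. -/
noncomputable def fejer (v : ℝ) : ℝ := ∫ y in (0 : ℝ)..1, (1 - y) * Real.cos (y * v)

lemma fejer_eq {v : ℝ} (hv : v ≠ 0) : fejer v = (1 - Real.cos v) / v ^ 2 := by
  have h : ∀ y ∈ uIcc (0 : ℝ) 1, HasDerivAt
      (fun y => (1 - y) * (Real.sin (y * v) / v) - Real.cos (y * v) / v ^ 2)
      ((1 - y) * Real.cos (y * v)) y := by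
    intro y _
    have h1 : HasDerivAt (fun y : ℝ => y * v) v y := by
      simpa using (hasDerivAt_id y).mul_const v
    have h2 := ((hasDerivAt_id y).const_sub 1).mul (h1.sin.div_const v)
    convert! h2.sub (h1.cos.div_const (v ^ 2)) using 1
    simp only [id]
    field_simp
    ring
  rw [fejer, intervalIntegral.integral_eq_sub_of_hasDerivAt h
    (Continuous.intervalIntegrable (by fun_prop) _ _)]
  simp
  ring

lemma fejer_zero : fejer 0 = 1 / 2 := by
  have h : ∀ y ∈ uIcc (0 : ℝ) 1, HasDerivAt (fun y : ℝ => y - y ^ 2 / 2) (1 - y) y := fun y _ => by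
    convert! (hasDerivAt_id y).sub ((hasDerivAt_pow 2 y).div_const 2) using 1
    simp
  simp only [fejer, mul_zero, Real.cos_zero, mul_one]
  rw [intervalIntegral.integral_eq_sub_of_hasDerivAt h
    (Continuous.intervalIntegrable (by fun_prop) _ _)]
  norm_num

lemma fejer_nonneg (v : ℝ) : 0 ≤ fejer v := by
  rcases eq_or_ne v 0 with rfl | hv
  · rw [fejer_zero]; norm_num
  · rw [fejer_eq hv]
    exact div_nonneg (sub_nonneg.2 (Real.cos_le_one v)) (sq_nonneg v)

lemma fejer_le (v : ℝ) : fejer v ≤ 3 * (1 + v ^ 2)⁻¹ := by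
  rcases eq_or_ne v 0 with rfl | hv
  · rw [fejer_zero]; norm_num
  · have h2 : 0 < v ^ 2 := by positivity
    rw [fejer_eq hv, ← div_eq_mul_inv, div_le_div_iff₀ h2 (by positivity)]
    nlinarith [Real.neg_one_le_cos v, Real.one_sub_sq_div_two_le_cos (x := v),
      mul_le_mul_of_nonneg_right (show 1 - Real.cos v ≤ 2 by linarith [Real.neg_one_le_cos v]) h2.le]

lemma continuous_fejer : Continuous fejer := by
  unfold fejer
  exact intervalIntegral.continuous_parametric_intervalIntegral_of_continuous' (by fun_prop) _ _

lemma integrable_fejer : Integrable fejer :=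
  (integrable_inv_one_add_sq.const_mul 3).mono' continuous_fejer.aestronglyMeasurable
    (ae_of_all _ fun v => by
      rw [Real.norm_of_nonneg (fejer_nonneg v)]; exact fejer_le v)

lemma integral_fejer_pos : 0 < ∫ v, fejer v :=
  integral_pos_of_integrable_nonneg_nonzero (x := 0) continuous_fejer integrable_fejer
    fejer_nonneg (by rw [fejer_zero]; norm_num)

lemma integrable_fejer_comp {l : ℝ} (hl : 0 < l) (x : ℝ) :
    Integrable fun t => fejer (l * (x - t)) :=
  (integrable_fejer.comp_mul_left' hl.ne').comp_sub_left x

/-- The Fejér mean of a function which is at least `η` near `x` and bounded below by `-C`. -/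
lemma exists_le_integral_mul_fejer {C η h : ℝ} (hC : 0 ≤ C) (hη : 0 < η) (hh : 0 < h) :
    ∃ l > 0, ∃ δ > 0, ∀ φ : ℝ → ℝ, Measurable φ → (∀ t > 0, |φ t| ≤ C) →
      ∀ x > h, (∀ t ∈ Icc (x - h) (x + h), η ≤ φ t) →
        δ ≤ ∫ t in Ioi 0, φ t * fejer (l * (x - t)) := by
  have hI := integral_fejer_pos
  set I := ∫ v, fejer v with hIdef
  -- The hypotheses give `φ ≥ (η + C) · 1_window - C`. As `l` grows the kernel concentrates in the
  -- window, so the mean of this minorant, up to the factor `1/l`, tends to `η I > 0`.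
  have hlim : Tendsto (fun l : ℝ => (η + C) * (∫ v in (-(l * h))..(l * h), fejer v) - C * I) atTop
      (𝓝 ((η + C) * I - C * I)) := by
    have h1 : Tendsto (fun l : ℝ => l * h) atTop atTop := tendsto_id.atTop_mul_const hh
    exact ((intervalIntegral_tendsto_integral integrable_fejer
      (tendsto_neg_atTop_atBot.comp h1) h1).const_mul _).sub_const _
  have hpos : 0 < (η + C) * I - C * I := by nlinarith [mul_pos hη hI]
  obtain ⟨l, hl, hl0⟩ := ((hlim.eventually (lt_mem_nhds hpos)).and (eventually_gt_atTop 0)).exists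
  refine ⟨l, hl0, l⁻¹ * ((η + C) * (∫ v in (-(l * h))..(l * h), fejer v) - C * I), by positivity, ?_⟩
  intro φ hφm hφ x hx hη'
  have hint := integrable_fejer_comp hl0 x
  have hsub : Icc (x - h) (x + h) ⊆ Ioi 0 := fun t ht => by
    have := ht.1; simp only [mem_Ioi]; linarith
  have e1 : ∫ t in Icc (x - h) (x + h), fejer (l * (x - t))
      = l⁻¹ * ∫ v in (-(l * h))..(l * h), fejer v := by
    rw [integral_Icc_eq_integral_Ioc, ← intervalIntegral.integral_of_le (by linarith)]
    have := intervalIntegral.integral_comp_sub_left (a := x - h) (b := x + h)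
      (fun u => fejer (l * u)) x
    rw [this, intervalIntegral.integral_comp_mul_left _ hl0.ne', smul_eq_mul]
    congr 2 <;> ring
  have e2 : ∫ t, fejer (l * (x - t)) = l⁻¹ * I := by
    rw [integral_sub_left_eq_self (fun u => fejer (l * u)) volume x,
      Measure.integral_comp_mul_left, smul_eq_mul, abs_of_pos (inv_pos.2 hl0)]
  calc l⁻¹ * ((η + C) * (∫ v in (-(l * h))..(l * h), fejer v) - C * I)
      = (η + C) * (∫ t in Icc (x - h) (x + h), fejer (l * (x - t)))
        - C * ∫ t, fejer (l * (x - t)) := by rw [e1, e2]; ring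
    _ ≤ (η + C) * (∫ t in Icc (x - h) (x + h), fejer (l * (x - t)))
        - C * ∫ t in Ioi 0, fejer (l * (x - t)) := by
      exact sub_le_sub_left (mul_le_mul_of_nonneg_left
        (setIntegral_le_integral hint (ae_of_all _ fun t => fejer_nonneg _)) hC) _
    _ = ∫ t in Ioi 0, ((η + C) * (Icc (x - h) (x + h)).indicator (fun t => fejer (l * (x - t))) t
          - C * fejer (l * (x - t))) := by
      rw [integral_sub, integral_const_mul, integral_const_mul,
        setIntegral_indicator measurableSet_Icc, inter_eq_right.2 hsub]
      · exact ((hint.indicator measurableSet_Icc).const_mul _).integrableOn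
      · exact (hint.const_mul _).integrableOn
    _ ≤ ∫ t in Ioi 0, φ t * fejer (l * (x - t)) := by
      refine setIntegral_mono_on ?_ ?_ measurableSet_Ioi fun t ht => ?_
      · exact (((hint.indicator measurableSet_Icc).const_mul _).sub
          (hint.const_mul _)).integrableOn
      · refine Integrable.mono' (hint.const_mul C).integrableOn ?_ ?_
        · exact (hφm.aestronglyMeasurable).mul hint.aestronglyMeasurable.restrict
        · refine (ae_restrict_iff' measurableSet_Ioi).2 (ae_of_all _ fun t ht => ?_)
          rw [norm_mul, Real.norm_eq_abs, Real.norm_of_nonneg (fejer_nonneg _)]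
          exact mul_le_mul_of_nonneg_right (hφ t ht) (fejer_nonneg _)
      · have hf := fejer_nonneg (l * (x - t))
        have := neg_le_of_abs_le (hφ t ht)
        by_cases hm : t ∈ Icc (x - h) (x + h)
        · rw [indicator_of_mem hm]
          have := hη' t hm
          nlinarith
        · rw [indicator_of_notMem hm]
          nlinarith

/-! ### A Wiener–Ikehara theorem -/

section WienerIkehara

variable {φ : ℝ → ℝ} {C : ℝ} {G : ℂ → ℂ}

lemma re_integral_triangle (v : ℝ) :
    (∫ y in (0 : ℝ)..1, ((1 - y : ℝ) : ℂ) * Complex.exp (y * v * Complex.I)).re = fejer v := by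
  have h : IntervalIntegrable (fun y : ℝ => ((1 - y : ℝ) : ℂ) * Complex.exp (y * v * Complex.I))
      volume 0 1 := Continuous.intervalIntegrable (by fun_prop) _ _
  rw [fejer, ← Complex.reCLM_apply, ← Complex.reCLM.intervalIntegral_comp_comm h]
  refine intervalIntegral.integral_congr fun y _ => ?_
  simp only [Complex.reCLM_apply, Complex.re_ofReal_mul]
  rw [← Complex.ofReal_mul, Complex.exp_ofReal_mul_I_re]

lemma integrableOn_mul_exp_neg (hφm : Measurable φ) (hφ : ∀ t > 0, |φ t| ≤ C) {ε : ℝ} (hε : 0 < ε) :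
    IntegrableOn (fun t => φ t * Real.exp (-ε * t)) (Ioi 0) := by
  refine Integrable.mono' ((exp_neg_integrableOn_Ioi 0 hε).const_mul C)
    (by fun_prop) ((ae_restrict_iff' measurableSet_Ioi).2 (ae_of_all _ fun t ht => ?_))
  rw [norm_mul, Real.norm_eq_abs, Real.norm_of_nonneg (Real.exp_pos _).le]
  exact mul_le_mul_of_nonneg_right (hφ t ht) (Real.exp_pos _).le

/-- Expand the kernel as a cosine transform and exchange the integrals: the inner one is the Laplace
transform at `ε + i y l`. The damping `exp (-ε t)` is what makes Fubini applicable. -/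
lemma integral_mul_exp_mul_fejer (hφm : Measurable φ) (hφ : ∀ t > 0, |φ t| ≤ C)
    (hG : ∀ z : ℂ, 0 < z.re → ∫ t in Ioi (0 : ℝ), (φ t : ℂ) * Complex.exp (-z * t) = G z)
    {ε : ℝ} (hε : 0 < ε) (l x : ℝ) :
    ∫ t in Ioi 0, φ t * Real.exp (-ε * t) * fejer (l * (x - t)) =
      (∫ y in (0 : ℝ)..1, ((1 - y : ℝ) : ℂ) * Complex.exp (y * (l * x) * Complex.I) *
        G (ε + y * l * Complex.I)).re := by
  set F : ℝ → ℝ → ℂ := fun y t => ((φ t * Real.exp (-ε * t) : ℝ) : ℂ) *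
    (((1 - y : ℝ) : ℂ) * Complex.exp (y * (l * (x - t) : ℝ) * Complex.I)) with hF
  have hint : Integrable (Function.uncurry F)
      ((volume.restrict (Ioc (0 : ℝ) 1)).prod (volume.restrict (Ioi (0 : ℝ)))) := by
    have hg : Integrable (fun p : ℝ × ℝ => (1 : ℝ) * ‖φ p.2 * Real.exp (-ε * p.2)‖)
        ((volume.restrict (Ioc (0 : ℝ) 1)).prod (volume.restrict (Ioi (0 : ℝ)))) :=
      Integrable.mul_prod (f := fun _ => (1 : ℝ)) (integrable_const _)
        (integrableOn_mul_exp_neg hφm hφ hε).norm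
    refine hg.mono' ?_ ?_
    · refine Measurable.aestronglyMeasurable ?_
      simp only [hF, Function.uncurry_def]
      fun_prop
    · rw [Measure.prod_restrict]
      refine (ae_restrict_iff' (measurableSet_Ioc.prod measurableSet_Ioi)).2
        (ae_of_all _ fun p hp => ?_)
      simp only [Function.uncurry_def, hF, norm_mul, Complex.norm_real, one_mul]
      rw [← Complex.ofReal_mul, Complex.norm_exp_ofReal_mul_I, mul_one]
      refine mul_le_of_le_one_right (by positivity) ?_
      have := hp.1.1
      have := hp.1.2
      rw [Real.norm_eq_abs, abs_le]
      constructor <;> linarith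
  have e1 : ∀ y : ℝ, ∫ t in Ioi (0 : ℝ), F y t =
      ((1 - y : ℝ) : ℂ) * Complex.exp (y * (l * x) * Complex.I) * G (ε + y * l * Complex.I) := by
    intro y
    rw [← hG _ (by simpa using hε), ← integral_const_mul]
    refine integral_congr_ae (ae_of_all _ fun t => ?_)
    simp only [hF, Complex.ofReal_mul, Complex.ofReal_exp]
    have e : Complex.exp (y * (l * x) * Complex.I) *
        Complex.exp (-(ε + y * l * Complex.I) * t) =
        Complex.exp ((-ε : ℝ) * t) * Complex.exp (y * (l * (x - t : ℝ)) * Complex.I) := by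
      rw [← Complex.exp_add, ← Complex.exp_add]
      congr 1
      push_cast
      ring
    linear_combination -((1 - y : ℝ) : ℂ) * (φ t) * e
  have e2 : ∀ t : ℝ, ∫ y in Ioc (0 : ℝ) 1, F y t = ((φ t * Real.exp (-ε * t) : ℝ) : ℂ) *
      ∫ y in (0 : ℝ)..1, ((1 - y : ℝ) : ℂ) * Complex.exp (y * (l * (x - t) : ℝ) * Complex.I) := by
    intro t
    rw [intervalIntegral.integral_of_le zero_le_one, ← integral_const_mul]
  rw [intervalIntegral.integral_of_le zero_le_one]
  simp_rw [← e1]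
  rw [integral_integral_swap hint, ← Complex.reCLM_apply,
    ← Complex.reCLM.integral_comp_comm (φ := fun t => ∫ y in Ioc (0 : ℝ) 1, F y t)
      hint.integral_prod_right]
  refine integral_congr_ae (ae_of_all _ fun t => ?_)
  simp only [Complex.reCLM_apply, e2, Complex.re_ofReal_mul, re_integral_triangle]

/-- This is the limit `ε → 0+` of the damped identity. The left side is dominated by `C` times the
kernel, the right side by the maximum of `G` on a compact rectangle that touches the imaginary axis.
-/
lemma integral_mul_fejer (hφm : Measurable φ) (hφ : ∀ t > 0, |φ t| ≤ C)
    (hG : ∀ z : ℂ, 0 < z.re → ∫ t in Ioi (0 : ℝ), (φ t : ℂ) * Complex.exp (-z * t) = G z)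
    (hGc : ContinuousOn G {z | 0 ≤ z.re}) {l : ℝ} (hl : 0 < l) (x : ℝ) :
    ∫ t in Ioi 0, φ t * fejer (l * (x - t)) =
      (∫ y in (0 : ℝ)..1, ((1 - y : ℝ) : ℂ) * Complex.exp (y * (l * x) * Complex.I) *
        G (y * l * Complex.I)).re := by
  have h1 : Tendsto (fun ε : ℝ => ∫ t in Ioi 0, φ t * Real.exp (-ε * t) * fejer (l * (x - t)))
      (𝓝[>] 0) (𝓝 (∫ t in Ioi 0, φ t * fejer (l * (x - t)))) := by
    refine tendsto_integral_filter_of_dominated_convergence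
      (fun t => C * fejer (l * (x - t))) ?_ ?_ ?_ ?_
    · refine Eventually.of_forall fun ε => ?_
      have := continuous_fejer.measurable
      exact Measurable.aestronglyMeasurable (by fun_prop)
    · filter_upwards [self_mem_nhdsWithin] with ε hε
      refine (ae_restrict_iff' measurableSet_Ioi).2 (ae_of_all _ fun t ht => ?_)
      rw [norm_mul, norm_mul, Real.norm_eq_abs, Real.norm_of_nonneg (Real.exp_pos _).le,
        Real.norm_of_nonneg (fejer_nonneg _)]
      refine mul_le_mul_of_nonneg_right ?_ (fejer_nonneg _)
      have : Real.exp (-ε * t) ≤ 1 := Real.exp_le_one_iff.2 (by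
        have := mul_pos (mem_Ioi.1 hε) (mem_Ioi.1 ht); linarith)
      exact (mul_le_of_le_one_right (abs_nonneg _) this).trans (hφ t ht)
    · exact ((integrable_fejer_comp hl x).const_mul C).integrableOn
    · refine ae_of_all _ fun t => ?_
      have : Continuous fun ε : ℝ => φ t * Real.exp (-ε * t) * fejer (l * (x - t)) := by fun_prop
      simpa using (this.tendsto 0).mono_left nhdsWithin_le_nhds
  have hcomp : IsCompact ((fun p : ℝ × ℝ => ((p.1 : ℂ) + p.2 * l * Complex.I)) ''
      (Icc 0 1 ×ˢ Icc 0 1)) := (isCompact_Icc.prod isCompact_Icc).image (by fun_prop)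
  obtain ⟨M, hM⟩ := hcomp.exists_bound_of_continuousOn (hGc.mono (by
    rintro _ ⟨p, hp, rfl⟩
    simpa using hp.1.1))
  have hM0 : ∀ ε ∈ Icc (0 : ℝ) 1, ∀ y ∈ Icc (0 : ℝ) 1, ‖G (ε + y * l * Complex.I)‖ ≤ M :=
    fun ε hε y hy => hM _ ⟨(ε, y), ⟨hε, hy⟩, rfl⟩
  have h2 : Tendsto (fun ε : ℝ => ∫ y in (0 : ℝ)..1, ((1 - y : ℝ) : ℂ) *
      Complex.exp (y * (l * x) * Complex.I) * G (ε + y * l * Complex.I)) (𝓝[>] 0)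
      (𝓝 (∫ y in (0 : ℝ)..1, ((1 - y : ℝ) : ℂ) *
      Complex.exp (y * (l * x) * Complex.I) * G (y * l * Complex.I))) := by
    refine intervalIntegral.tendsto_integral_filter_of_dominated_convergence (fun _ => M) ?_ ?_ ?_ ?_
    · filter_upwards [self_mem_nhdsWithin] with ε hε
      refine ContinuousOn.aestronglyMeasurable (ContinuousOn.mul (by fun_prop) ?_)
        measurableSet_uIoc
      refine hGc.comp (by fun_prop) fun y _ => ?_
      simpa using (mem_Ioi.1 hε).le
    · filter_upwards [Ioo_mem_nhdsGT (zero_lt_one' ℝ)] with ε hε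
      refine ae_of_all _ fun y hy => ?_
      rw [uIoc_of_le zero_le_one] at hy
      rw [norm_mul, norm_mul, Complex.norm_real]
      have e : ‖Complex.exp (y * (l * x) * Complex.I)‖ = 1 := by
        rw [← Complex.ofReal_mul, ← Complex.ofReal_mul, Complex.norm_exp_ofReal_mul_I]
      rw [e, mul_one]
      have h3 := hM0 ε ⟨hε.1.le, hε.2.le⟩ y ⟨hy.1.le, hy.2⟩
      refine (mul_le_of_le_one_left (norm_nonneg _) ?_).trans h3
      rw [Real.norm_eq_abs, abs_le]
      constructor <;> linarith [hy.1, hy.2]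
    · exact intervalIntegrable_const
    · refine ae_of_all _ fun y _ => Tendsto.const_mul _ ?_
      have h3 : Tendsto (fun ε : ℝ => (ε : ℂ) + y * l * Complex.I) (𝓝[>] 0)
          (𝓝[{z | 0 ≤ z.re}] (y * l * Complex.I)) := by
        refine tendsto_nhdsWithin_iff.2 ⟨?_, ?_⟩
        · have : Continuous fun ε : ℝ => (ε : ℂ) + y * l * Complex.I := by fun_prop
          simpa using (this.tendsto 0).mono_left nhdsWithin_le_nhds
        · filter_upwards [self_mem_nhdsWithin] with ε hε
          simpa using (mem_Ioi.1 hε).le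
      exact (hGc _ (by simp)).tendsto.comp h3
  refine tendsto_nhds_unique h1 (((Complex.continuous_re.tendsto _).comp h2).congr' ?_)
  filter_upwards [self_mem_nhdsWithin] with ε hε
  exact (integral_mul_exp_mul_fejer hφm hφ hG hε l x).symm

/-- After passage to the transform side, `x` occurs only as a frequency, so this is the
Riemann–Lebesgue lemma. -/
lemma tendsto_integral_mul_fejer (hφm : Measurable φ) (hφ : ∀ t > 0, |φ t| ≤ C)
    (hG : ∀ z : ℂ, 0 < z.re → ∫ t in Ioi (0 : ℝ), (φ t : ℂ) * Complex.exp (-z * t) = G z)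
    (hGc : ContinuousOn G {z | 0 ≤ z.re}) {l : ℝ} (hl : 0 < l) :
    Tendsto (fun x => ∫ t in Ioi 0, φ t * fejer (l * (x - t))) atTop (𝓝 0) := by
  simp_rw [integral_mul_fejer hφm hφ hG hGc hl]
  have h := Real.tendsto_integral_exp_smul_cocompact
    ((Ioc (0 : ℝ) 1).indicator fun y => ((1 - y : ℝ) : ℂ) * G (y * l * Complex.I))
  -- The Fourier character is `exp (2πi ·)` with a minus sign in the transform, hence this frequency
  -- for the phase `y l x`.
  have hx : Tendsto (fun x : ℝ => -(l * x) / (2 * Real.pi)) atTop (cocompact ℝ) := by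
    refine Tendsto.mono_right ?_ atBot_le_cocompact
    refine Tendsto.atBot_div_const (by positivity) ?_
    exact tendsto_neg_atTop_atBot.comp (tendsto_id.const_mul_atTop hl)
  have h2 := (Complex.continuous_re.tendsto _).comp (h.comp hx)
  simp only [Complex.zero_re] at h2
  refine h2.congr fun x => ?_
  simp only [Function.comp_apply]
  congr 1
  rw [intervalIntegral.integral_of_le zero_le_one, ← integral_indicator measurableSet_Ioc]
  congr 1
  ext y
  by_cases hy : y ∈ Ioc (0 : ℝ) 1
  · rw [indicator_of_mem hy, indicator_of_mem hy, Circle.smul_def, Real.fourierChar_apply,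
      smul_eq_mul]
    rw [show (2 * Real.pi * -(y * (-(l * x) / (2 * Real.pi))) : ℝ) = y * (l * x) by
      field_simp]
    push_cast
    ring
  · rw [indicator_of_notMem hy, indicator_of_notMem hy, smul_zero]

/-- A form of the **Wiener–Ikehara theorem** for bounded functions. -/
theorem tendsto_one_of_laplace {B : ℝ → ℝ} (hBm : Measurable B) (hB : ∀ t > 0, |B t - 1| ≤ C)
    (hB0 : ∀ t, 0 ≤ B t) (hmono : Monotone fun t => B t * Real.exp t)
    (hG : ∀ z : ℂ, 0 < z.re →
      ∫ t in Ioi (0 : ℝ), ((B t - 1 : ℝ) : ℂ) * Complex.exp (-z * t) = G z)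
    (hGc : ContinuousOn G {z | 0 ≤ z.re}) :
    Tendsto B atTop (𝓝 1) := by
  have hC : 0 ≤ C := (abs_nonneg _).trans (hB 1 one_pos)
  have hstep : ∀ s t : ℝ, s ≤ t → B s * Real.exp (s - t) ≤ B t := fun s t hst => by
    have := hmono hst
    simp only at this
    rw [Real.exp_sub, ← mul_div_assoc, div_le_iff₀ (Real.exp_pos _)]
    exact this
  rw [tendsto_order]
  constructor
  · intro a ha
    by_contra hcon
    -- A low value propagates to the left: monotonicity of `B t * exp t` gives `B t ≤ a * exp (x -
    -- t)` for `t ≤ x`. So `1 - B` stays above a positive constant on a window of fixed length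
    -- ending at `x`, against the vanishing of its Fejér means.
    have hfreq : ∃ᶠ x in atTop, B x ≤ a := by
      simpa [Filter.Frequently, not_le] using hcon
    have hcont : Tendsto (fun h : ℝ => 1 - max a 0 * Real.exp (2 * h)) (𝓝[>] 0)
        (𝓝 (1 - max a 0)) := by
      have : Continuous fun h : ℝ => 1 - max a 0 * Real.exp (2 * h) := by fun_prop
      simpa using (this.tendsto 0).mono_left nhdsWithin_le_nhds
    have ha' : 0 < 1 - max a 0 := by
      have := max_lt ha one_pos; linarith
    obtain ⟨h, hη, hh⟩ := ((hcont.eventually (lt_mem_nhds ha')).and self_mem_nhdsWithin).exists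
    obtain ⟨l, hl, δ, hδ, hmain⟩ := exists_le_integral_mul_fejer hC hη hh
    have hlim := (tendsto_integral_mul_fejer (hBm.sub_const 1) hB hG hGc hl).comp
      (tendsto_atTop_add_const_right atTop (-h) tendsto_id)
    have hlim' := hlim.neg
    simp only [neg_zero] at hlim'
    obtain ⟨x, hx, hx1, hx2⟩ := (hfreq.and_eventually
      ((hlim'.eventually (gt_mem_nhds hδ)).and (eventually_gt_atTop (2 * h)))).exists
    have := hmain (fun t => -(B t - 1)) (hBm.sub_const 1).neg (fun t ht => by
      rw [abs_neg]; exact hB t ht) (x + -h) (by linarith) (fun t ht => ?_)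
    · simp only [Function.comp_apply, id, ← integral_neg] at hx1
      simp only [neg_mul] at this
      linarith
    · have h1 := hstep t x (by linarith [ht.2])
      have h2 : B t ≤ a * Real.exp (x - t) := by
        rw [show t - x = -(x - t) by ring, Real.exp_neg, ← div_eq_mul_inv,
          div_le_iff₀ (Real.exp_pos _)] at h1
        exact h1.trans (mul_le_mul_of_nonneg_right hx (Real.exp_pos _).le)
      have h3 : a * Real.exp (x - t) ≤ max a 0 * Real.exp (2 * h) :=
        mul_le_mul (le_max_left _ _) (Real.exp_le_exp.2 (by linarith [ht.1]))
          (Real.exp_pos _).le (le_max_right _ _)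
      linarith
  · intro a ha
    by_contra hcon
    -- A high value propagates to the right, so the window now starts at `x` and is centred at `x +
    -- h`.
    have hfreq : ∃ᶠ x in atTop, a ≤ B x := by
      simpa [Filter.Frequently, not_le] using hcon
    have hcont : Tendsto (fun h : ℝ => a * Real.exp (-(2 * h)) - 1) (𝓝[>] 0)
        (𝓝 (a - 1)) := by
      have : Continuous fun h : ℝ => a * Real.exp (-(2 * h)) - 1 := by fun_prop
      simpa using (this.tendsto 0).mono_left nhdsWithin_le_nhds
    obtain ⟨h, hη, hh⟩ := ((hcont.eventually (lt_mem_nhds (sub_pos.2 ha))).and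
      self_mem_nhdsWithin).exists
    obtain ⟨l, hl, δ, hδ, hmain⟩ := exists_le_integral_mul_fejer hC hη hh
    have hlim := (tendsto_integral_mul_fejer (hBm.sub_const 1) hB hG hGc hl).comp
      (tendsto_atTop_add_const_right atTop h tendsto_id)
    obtain ⟨x, hx, hx1, hx2⟩ := (hfreq.and_eventually
      ((hlim.eventually (gt_mem_nhds hδ)).and (eventually_gt_atTop (2 * h)))).exists
    have hh' : 0 < h := hh
    have := hmain (fun t => B t - 1) (hBm.sub_const 1) hB (x + h) (by linarith) (fun t ht => ?_)
    · simp only [Function.comp_apply, id] at hx1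
      linarith
    · have h1 := hstep x t (by linarith [ht.1])
      have h3 : a * Real.exp (-(2 * h)) ≤ B x * Real.exp (x - t) :=
        mul_le_mul hx (Real.exp_le_exp.2 (by linarith [ht.2])) (Real.exp_pos _).le (hB0 x)
      linarith

end WienerIkehara

/-! ### The prime number theorem -/

section PrimeNumberTheorem

open Chebyshev ArithmeticFunction

lemma integral_comp_exp_mul_exp {E : Type*} [NormedAddCommGroup E] [NormedSpace ℝ E] (g : ℝ → E) :
    ∫ t in Ioi (0 : ℝ), Real.exp t • g (Real.exp t) = ∫ u in Ioi (1 : ℝ), g u := by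
  have himg : Real.exp '' Ioi 0 = Ioi 1 := by
    ext u
    simp only [mem_image, mem_Ioi]
    constructor
    · rintro ⟨t, ht, rfl⟩
      exact Real.one_lt_exp_iff.2 ht
    · intro hu
      exact ⟨Real.log u, Real.log_pos hu, Real.exp_log (by linarith)⟩
  rw [← himg, integral_image_eq_integral_abs_deriv_smul measurableSet_Ioi
    (fun x _ => (Real.hasDerivAt_exp x).hasDerivWithinAt) Real.exp_injective.injOn]
  simp only [abs_of_pos (Real.exp_pos _)]

lemma sum_vonMangoldt_isBigO :
    (fun n : ℕ => ∑ k ∈ Finset.Icc 1 n, vonMangoldt k) =O[atTop] fun n => (n : ℝ) ^ (1 : ℝ) := by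
  refine IsBigO.of_bound (Real.log 4 + 4) (Eventually.of_forall fun n => ?_)
  have h : ∑ k ∈ Finset.Icc 1 n, vonMangoldt k = ψ n := by
    rw [psi, Nat.floor_natCast]; rfl
  rw [h, Real.norm_of_nonneg (psi_nonneg _), Real.rpow_one, Real.norm_of_nonneg n.cast_nonneg]
  exact psi_le_const_mul_self n.cast_nonneg

/-- Abel summation, followed by the substitution `u = exp t`. -/
lemma LSeries_vonMangoldt_eq_integral {s : ℂ} (hs : 1 < s.re) :
    LSeries (fun n => (vonMangoldt n : ℂ)) s =
      s * ∫ t in Ioi (0 : ℝ), ((ψ (Real.exp t) * Real.exp (-t) : ℝ) : ℂ) *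
        Complex.exp (-(s - 1) * t) := by
  rw [LSeries_eq_mul_integral_of_nonneg (fun n => vonMangoldt n) zero_le_one hs
    sum_vonMangoldt_isBigO (fun n => vonMangoldt_nonneg), ← integral_comp_exp_mul_exp]
  congr 1
  refine setIntegral_congr_fun measurableSet_Ioi fun t _ => ?_
  have h : ∑ k ∈ Finset.Icc 1 ⌊Real.exp t⌋₊, (vonMangoldt k : ℂ) = (ψ (Real.exp t) : ℂ) := by
    rw [psi, Complex.ofReal_sum]; rfl
  have hne : ((Real.exp t : ℝ) : ℂ) ≠ 0 := Complex.ofReal_ne_zero.2 (Real.exp_pos t).ne'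
  simp only [h]
  rw [Complex.cpow_def_of_ne_zero hne, ← Complex.ofReal_log (Real.exp_pos t).le, Real.log_exp,
    Complex.real_smul, Complex.ofReal_mul, Complex.ofReal_exp, Complex.ofReal_exp]
  have e : Complex.exp t * Complex.exp (t * -(s + 1)) =
      Complex.exp ((-t : ℝ) : ℂ) * Complex.exp (-(s - 1) * t) := by
    rw [← Complex.exp_add, ← Complex.exp_add]
    congr 1
    push_cast
    ring
  linear_combination (ψ (Real.exp t) : ℂ) * e

/-- Modulus one turns the auxiliary function of Dirichlet's theorem into the von Mangoldt series
minus its pole `1/(s - 1)`. -/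
lemma residueClass_one : vonMangoldt.residueClass (1 : ZMod 1) = fun n => vonMangoldt n := by
  ext n
  have h : n ∈ {m : ℕ | (m : ZMod 1) = 1} := Subsingleton.elim (n : ZMod 1) 1
  exact indicator_of_mem h _

/-- The **prime number theorem**, for the Chebyshev function `ψ`. -/
theorem psi_isEquivalent : ψ ~[atTop] fun x => x := by
  have hpsi0 : ∀ t, 0 ≤ ψ (Real.exp t) * Real.exp (-t) := fun t =>
    mul_nonneg (psi_nonneg _) (Real.exp_pos _).le
  have hpsiC : ∀ t, ψ (Real.exp t) * Real.exp (-t) ≤ Real.log 4 + 4 := fun t => by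
    have := mul_le_mul_of_nonneg_right (psi_le_const_mul_self (Real.exp_pos t).le)
      (Real.exp_pos (-t)).le
    rwa [mul_assoc, ← Real.exp_add, add_neg_cancel, Real.exp_zero, mul_one] at this
  have hm : Measurable fun t => ψ (Real.exp t) * Real.exp (-t) :=
    (psi_mono.measurable.comp Real.measurable_exp).mul (by fun_prop)
  have hlog4 : 0 < Real.log 4 := Real.log_pos (by norm_num)
  have key := tendsto_one_of_laplace (C := Real.log 4 + 4)
    (B := fun t => ψ (Real.exp t) * Real.exp (-t))
    -- With `A` the series minus its pole, the transform is `(A(1+z) + 1/z)/(1+z) - 1/z`, and the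
    -- poles at `z = 0` cancel to leave this quotient.
    (G := fun z => (vonMangoldt.LFunctionResidueClassAux (1 : ZMod 1) (1 + z) - 1) / (1 + z))
    hm (fun t _ => by
      rw [abs_le]; constructor <;> linarith [hpsi0 t, hpsiC t]) hpsi0
    (by
      intro a b hab
      simp only [mul_assoc, ← Real.exp_add, neg_add_cancel, Real.exp_zero, mul_one]
      exact psi_mono (Real.exp_le_exp.2 hab)) ?_ ?_
  · have h := key.comp Real.tendsto_log_atTop
    refine (isEquivalent_iff_tendsto_one ?_).2 (h.congr' ?_)
    · filter_upwards [eventually_gt_atTop 0] with x hx using hx.ne'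
    · filter_upwards [eventually_gt_atTop 0] with x hx
      simp only [Function.comp_apply, Pi.div_apply, Real.exp_neg, Real.exp_log hx, div_eq_mul_inv]
  · intro z hz
    have hz0 : z ≠ 0 := fun h => by simp [h] at hz
    have hz1 : 1 + z ≠ 0 := fun h => by
      have := congrArg Complex.re h; simp at this; linarith
    have h1z : 1 < (1 + z).re := by simpa using hz
    have hexp : IntegrableOn (fun t : ℝ => Complex.exp (-z * t)) (Ioi 0) :=
      integrableOn_exp_mul_complex_Ioi (by simpa using hz) 0
    have hL := LSeries_vonMangoldt_eq_integral h1z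
    rw [add_sub_cancel_left] at hL
    have hA := vonMangoldt.eqOn_LFunctionResidueClassAux (a := (1 : ZMod 1)) isUnit_one h1z
    simp only [residueClass_one, add_sub_cancel_left, Nat.totient_one, Nat.cast_one, inv_one] at hA
    simp only [Complex.ofReal_sub, sub_mul, Complex.ofReal_one, one_mul]
    rw [integral_sub, integral_exp_mul_complex_Ioi (by simpa using hz), hA, hL]
    · generalize (∫ t in Ioi (0 : ℝ), ((ψ (Real.exp t) * Real.exp (-t) : ℝ) : ℂ) *
        Complex.exp (-z * t)) = J
      rw [Complex.ofReal_zero, mul_zero, Complex.exp_zero]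
      field_simp
      ring
    · refine (hexp.norm.const_mul (Real.log 4 + 4)).mono' ?_ (ae_of_all _ fun t => ?_)
      · exact ((Complex.measurable_ofReal.comp hm).mul (by fun_prop)).aestronglyMeasurable
      · rw [norm_mul, Complex.norm_real, Real.norm_of_nonneg (hpsi0 t)]
        exact mul_le_mul_of_nonneg_right (hpsiC t) (norm_nonneg _)
    · exact hexp
  · refine ContinuousOn.div (ContinuousOn.sub ?_ continuousOn_const) (by fun_prop) ?_
    · refine (vonMangoldt.continuousOn_LFunctionResidueClassAux (1 : ZMod 1)).comp (by fun_prop) ?_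
      intro z hz
      simpa using hz
    · intro z hz h
      have := congrArg Complex.re h
      simp at this hz
      linarith

/-- The **prime number theorem**, for the Chebyshev function `θ`. -/
theorem theta_isEquivalent : θ ~[atTop] fun x => x := by
  have h : (ψ - θ) =o[atTop] fun x : ℝ => x := by
    -- Proper prime powers contribute only `O(√x)`.
    refine isBigO_psi_sub_theta_sqrt.trans_isLittleO ?_
    refine (isLittleO_iff_tendsto' ?_).2
      ((tendsto_inv_atTop_zero.comp Real.tendsto_sqrt_atTop).congr fun x => ?_)
    · filter_upwards [eventually_gt_atTop 0] with x hx h using absurd h hx.ne'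
    · rw [Function.comp_apply, Real.sqrt_div_self]
  have h2 := psi_isEquivalent.sub_isLittleO h
  rwa [sub_sub_cancel] at h2

end PrimeNumberTheorem

/-! ### Sums of `1/p²` over primes -/

section PrimeSums

open Chebyshev

lemma hasDerivAt_inv_sq {t : ℝ} (ht : t ≠ 0) : HasDerivAt (fun t : ℝ => (t ^ 2)⁻¹) (-2 / t ^ 3) t := by
  convert! (hasDerivAt_pow 2 t).inv (pow_ne_zero 2 ht) using 1
  field_simp
  norm_num

/-- Abel summation; the weight `log p` makes the partial sums equal to `θ`. -/
lemma sum_log_div_sq_eq {a b : ℝ} (ha : 0 < a) (hab : a ≤ b) :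
    ∑ p ∈ Finset.Ioc ⌊a⌋₊ ⌊b⌋₊ with p.Prime, ((p : ℝ) ^ 2)⁻¹ * Real.log p =
      (b ^ 2)⁻¹ * θ b - (a ^ 2)⁻¹ * θ a + ∫ t in Ioc a b, 2 / t ^ 3 * θ t := by
  have hderiv : ∀ t ∈ Icc a b, deriv (fun t : ℝ => (t ^ 2)⁻¹) t = -2 / t ^ 3 := fun t ht =>
    (hasDerivAt_inv_sq (ha.trans_le ht.1).ne').deriv
  have hcont : ContinuousOn (fun t : ℝ => -2 / t ^ 3) (Icc a b) :=
    continuousOn_const.div (by fun_prop) fun t ht => pow_ne_zero 3 (ha.trans_le ht.1).ne'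
  have h := sum_mul_eq_sub_sub_integral_mul (fun n : ℕ => if n.Prime then Real.log n else 0)
    ha.le hab (f := fun t : ℝ => (t ^ 2)⁻¹)
    (fun t ht => (hasDerivAt_inv_sq (ha.trans_le ht.1).ne').differentiableAt)
    ((hcont.integrableOn_Icc).congr_fun (fun t ht => (hderiv t ht).symm) measurableSet_Icc)
  simp only [mul_ite, mul_zero, ← Finset.sum_filter, ← theta_eq_sum_Icc] at h
  rw [h, sub_eq_add_neg (_ - _), ← integral_neg]
  congr 1
  refine setIntegral_congr_fun measurableSet_Ioc fun t ht => ?_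
  rw [hderiv t (Ioc_subset_Icc_self ht)]
  ring

lemma integral_two_div_sq {a b : ℝ} (ha : 0 < a) (hab : a ≤ b) :
    IntegrableOn (fun t : ℝ => 2 / t ^ 2) (Ioc a b) ∧
      ∫ t in Ioc a b, 2 / t ^ 2 = 2 * (a⁻¹ - b⁻¹) := by
  have hd : ∀ t ∈ uIcc a b, HasDerivAt (fun t : ℝ => -2 * t⁻¹) (2 / t ^ 2) t := fun t ht => by
    rw [uIcc_of_le hab] at ht
    convert! (hasDerivAt_inv (ha.trans_le ht.1).ne').const_mul (-2) using 1
    ring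
  have hi : IntervalIntegrable (fun t : ℝ => 2 / t ^ 2) volume a b := by
    refine ContinuousOn.intervalIntegrable
      (continuousOn_const.div (by fun_prop) fun t ht => ?_)
    rw [uIcc_of_le hab] at ht
    exact pow_ne_zero 2 (ha.trans_le ht.1).ne'
  refine ⟨(intervalIntegrable_iff_integrableOn_Ioc_of_le hab).1 hi, ?_⟩
  rw [← intervalIntegral.integral_of_le hab, intervalIntegral.integral_eq_sub_of_hasDerivAt hd hi]
  ring

lemma integrableOn_theta_div_cube {a b : ℝ} (ha : 0 < a) :
    IntegrableOn (fun t : ℝ => 2 / t ^ 3 * θ t) (Ioc a b) := by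
  refine IntegrableOn.mono_set (t := Icc a b) ?_ Ioc_subset_Icc_self
  exact IntegrableOn.continuousOn_mul
    (continuousOn_const.div (by fun_prop) fun t ht => pow_ne_zero 3 (ha.trans_le ht.1).ne')
    ((theta_mono.monotoneOn _).integrableOn_isCompact isCompact_Icc) isCompact_Icc

lemma eventually_theta_bounds {ε : ℝ} (hε : 0 < ε) :
    ∀ᶠ a in atTop, ∀ t ≥ a, (1 - ε) * t ≤ θ t ∧ θ t ≤ (1 + ε) * t := by
  have h : ∀ᶠ t in atTop, (1 - ε) * t ≤ θ t ∧ θ t ≤ (1 + ε) * t := by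
    filter_upwards [theta_isEquivalent.isLittleO.bound hε, eventually_ge_atTop 0] with t ht h0
    rw [Pi.sub_apply, Real.norm_eq_abs, Real.norm_of_nonneg h0, abs_le] at ht
    constructor <;> linarith
  exact eventually_forall_ge_atTop.2 h

/-- Replacing `θ t` by `t` in the Abel formula gives `a⁻¹ - b⁻¹`. The two boundary terms and the
integral together cost at most `3ε a⁻¹`. -/
lemma eventually_sum_log_div_sq_bounds {ε : ℝ} (hε : 0 < ε) :
    ∀ᶠ a in atTop, ∀ b ≥ a,
      (1 - 3 * ε) * a⁻¹ - b⁻¹ ≤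
        ∑ p ∈ Finset.Ioc ⌊a⌋₊ ⌊b⌋₊ with p.Prime, ((p : ℝ) ^ 2)⁻¹ * Real.log p ∧
      ∑ p ∈ Finset.Ioc ⌊a⌋₊ ⌊b⌋₊ with p.Prime, ((p : ℝ) ^ 2)⁻¹ * Real.log p ≤
        (1 + 3 * ε) * a⁻¹ := by
  filter_upwards [eventually_theta_bounds hε, eventually_gt_atTop 0] with a hθ ha b hab
  have hb : 0 < b := ha.trans_le hab
  rw [sum_log_div_sq_eq ha hab]
  obtain ⟨hi, he⟩ := integral_two_div_sq ha hab
  have hθi := integrableOn_theta_div_cube (b := b) ha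
  have hdiv : ∀ x c : ℝ, 0 < x → (x ^ 2)⁻¹ * (c * x) = c * x⁻¹ := fun x c hx => by field_simp
  have hdiv3 : ∀ x c : ℝ, 0 < x → 2 / x ^ 3 * (c * x) = c * (2 / x ^ 2) := fun x c hx => by
    field_simp
  have hlo : (1 - ε) * (2 * (a⁻¹ - b⁻¹)) ≤ ∫ t in Ioc a b, 2 / t ^ 3 * θ t := by
    rw [← he, ← integral_const_mul]
    refine setIntegral_mono_on (hi.const_mul _) hθi measurableSet_Ioc fun t ht => ?_
    have ht0 := ha.trans ht.1
    rw [← hdiv3 t _ ht0]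
    exact mul_le_mul_of_nonneg_left (hθ t ht.1.le).1 (by positivity)
  have hup : ∫ t in Ioc a b, 2 / t ^ 3 * θ t ≤ (1 + ε) * (2 * (a⁻¹ - b⁻¹)) := by
    rw [← he, ← integral_const_mul]
    refine setIntegral_mono_on hθi (hi.const_mul _) measurableSet_Ioc fun t ht => ?_
    have ht0 := ha.trans ht.1
    rw [← hdiv3 t _ ht0]
    exact mul_le_mul_of_nonneg_left (hθ t ht.1.le).2 (by positivity)
  have ha1 := mul_le_mul_of_nonneg_left (hθ a le_rfl).1 (show 0 ≤ (a ^ 2)⁻¹ by positivity)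
  have ha2 := mul_le_mul_of_nonneg_left (hθ a le_rfl).2 (show 0 ≤ (a ^ 2)⁻¹ by positivity)
  have hb1 := mul_le_mul_of_nonneg_left (hθ b hab).1 (show 0 ≤ (b ^ 2)⁻¹ by positivity)
  have hb2 := mul_le_mul_of_nonneg_left (hθ b hab).2 (show 0 ≤ (b ^ 2)⁻¹ by positivity)
  rw [hdiv _ _ ha] at ha1 ha2
  rw [hdiv _ _ hb] at hb1 hb2
  have hbi : 0 < b⁻¹ := inv_pos.2 hb
  have hai : 0 < a⁻¹ := inv_pos.2 ha
  constructor <;> nlinarith [mul_pos hε hbi]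

lemma eventually_sum_inv_sq_le {ε : ℝ} (hε : 0 < ε) :
    ∀ᶠ a in atTop, ∀ b ≥ a,
      ∑ p ∈ Finset.Ioc ⌊a⌋₊ ⌊b⌋₊ with p.Prime, ((p : ℝ) ^ 2)⁻¹ ≤ (1 + ε) / (a * Real.log a) := by
  filter_upwards [eventually_sum_log_div_sq_bounds (show 0 < ε / 3 by positivity), eventually_gt_atTop 1] with a h ha b hab
  have hlog : 0 < Real.log a := Real.log_pos ha
  have ha0 : 0 < a := by linarith
  rw [← div_div, le_div_iff₀ hlog, Finset.sum_mul, div_eq_mul_inv]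
  refine le_trans (Finset.sum_le_sum fun p hp => ?_) ((h b hab).2.trans ?_)
  · have hp' := (Finset.mem_Ioc.1 (Finset.mem_filter.1 hp).1).1
    have : a < p := Nat.lt_of_floor_lt hp'
    exact mul_le_mul_of_nonneg_left (Real.log_le_log ha0 this.le) (by positivity)
  · refine mul_le_mul_of_nonneg_right ?_ (inv_pos.2 ha0).le
    linarith

lemma eventually_le_sum_inv_sq {ε : ℝ} (hε : 0 < ε) (hε1 : ε < 1) :
    ∀ᶠ a in atTop, ∃ b ≥ a, (1 - ε) / (a * Real.log a) ≤
      ∑ p ∈ Finset.Ioc ⌊a⌋₊ ⌊b⌋₊ with p.Prime, ((p : ℝ) ^ 2)⁻¹ := by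
  -- Cutting the sum at `b = M a` loses `b⁻¹ = (ε/3) a⁻¹`, while `log p ≤ log M + log a` with `log
  -- M` negligible. The bounds with `ε/9` lose another `ε/3`, and the last third pays for `log M`.
  set M := 3 / ε with hM
  have hM1 : 1 < M := by rw [hM, lt_div_iff₀ hε]; linarith
  filter_upwards [eventually_sum_log_div_sq_bounds (show 0 < ε / 9 by positivity),
    eventually_gt_atTop 1, Real.tendsto_log_atTop.eventually_ge_atTop (Real.log M * (3 / ε))]
    with a h ha hlogM
  have hlog : 0 < Real.log a := Real.log_pos ha
  have ha0 : 0 < a := by linarith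
  have hMa : a ≤ M * a := by nlinarith
  have hlM : 0 < Real.log M := Real.log_pos hM1
  have hmul : Real.log (M * a) = Real.log M + Real.log a :=
    Real.log_mul (by linarith) ha0.ne'
  have hlogMa : 0 < Real.log (M * a) := by rw [hmul]; linarith
  refine ⟨M * a, hMa, ?_⟩
  have h1 : (1 - 2 * ε / 3) * a⁻¹ ≤ (∑ p ∈ Finset.Ioc ⌊a⌋₊ ⌊M * a⌋₊ with p.Prime,
      ((p : ℝ) ^ 2)⁻¹) * Real.log (M * a) := by
    rw [Finset.sum_mul]
    refine le_trans ?_ ((h _ hMa).1.trans (Finset.sum_le_sum fun p hp => ?_))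
    · rw [hM]
      apply le_of_eq
      field_simp
      ring
    · have hp' := Finset.mem_Ioc.1 (Finset.mem_filter.1 hp).1
      have h3 : (p : ℝ) ≤ M * a := (Nat.le_floor_iff (by positivity)).1 hp'.2
      have h4 : a < p := Nat.lt_of_floor_lt hp'.1
      exact mul_le_mul_of_nonneg_left (Real.log_le_log (by linarith) h3) (by positivity)
  rw [← div_le_iff₀ hlogMa] at h1
  refine le_trans ?_ h1
  rw [← div_eq_mul_inv, div_div, div_le_div_iff₀ (by positivity) (by positivity)]
  have h5 : Real.log M ≤ Real.log a * (ε / 3) := by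
    have := mul_le_mul_of_nonneg_right hlogM (show 0 ≤ ε / 3 by positivity)
    rwa [mul_assoc, div_mul_div_comm, mul_comm ε, div_self (by positivity), mul_one] at this
  rw [hmul]
  nlinarith [mul_nonneg ha0.le (sub_nonneg.2 h5), mul_pos ha0 hlM, mul_pos (mul_pos ha0 hlM) hε]

end PrimeSums

/-! ### The Gauss measure of digit cells and the tail of the prime digit -/

section GaussMeasure

lemma log_two_pos : 0 < Real.log 2 := Real.log_pos one_lt_two

lemma gaussMeasure_apply {s : Set ℝ} (hs : MeasurableSet s) (hs1 : s ⊆ Ioc 0 1) :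
    gaussMeasure s = ∫⁻ x in s, ENNReal.ofReal (1 / (Real.log 2 * (1 + x))) := by
  rw [gaussMeasure, withDensity_apply _ hs, Measure.restrict_restrict hs, inter_eq_left.2 hs1]

lemma gaussMeasure_compl_Ioc : gaussMeasure (Ioc 0 1)ᶜ = 0 := by
  rw [gaussMeasure, withDensity_apply _ measurableSet_Ioc.compl,
    Measure.restrict_restrict measurableSet_Ioc.compl, compl_inter_self, Measure.restrict_empty,
    lintegral_zero_measure]

lemma gaussMeasure_Ioc_le {a b : ℝ} (ha : 0 ≤ a) (hb : b ≤ 1) :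
    gaussMeasure (Ioc a b) ≤ ENNReal.ofReal (1 / (Real.log 2 * (1 + a)) * (b - a)) := by
  have hl := log_two_pos
  rw [gaussMeasure_apply measurableSet_Ioc (Ioc_subset_Ioc ha hb),
    ENNReal.ofReal_mul (by positivity), ← Real.volume_Ioc, ← setLIntegral_const]
  refine setLIntegral_mono' measurableSet_Ioc fun x hx => ENNReal.ofReal_le_ofReal ?_
  exact one_div_le_one_div_of_le (by positivity)
    (mul_le_mul_of_nonneg_left (by linarith [hx.1]) hl.le)

lemma le_gaussMeasure_Ioc {a b : ℝ} (ha : 0 ≤ a) (hb0 : 0 ≤ b) (hb : b ≤ 1) :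
    ENNReal.ofReal (1 / (Real.log 2 * (1 + b)) * (b - a)) ≤ gaussMeasure (Ioc a b) := by
  have hl := log_two_pos
  rw [gaussMeasure_apply measurableSet_Ioc (Ioc_subset_Ioc ha hb),
    ENNReal.ofReal_mul (by positivity), ← Real.volume_Ioc, ← setLIntegral_const]
  refine setLIntegral_mono' measurableSet_Ioc fun x hx => ENNReal.ofReal_le_ofReal ?_
  exact one_div_le_one_div_of_le (mul_pos hl (by linarith [hx.1]))
    (mul_le_mul_of_nonneg_left (by linarith [hx.2]) hl.le)

instance : IsFiniteMeasure gaussMeasure := ⟨by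
  rw [← union_compl_self (Ioc (0 : ℝ) 1)]
  refine (measure_union_le _ _).trans_lt ?_
  rw [gaussMeasure_compl_Ioc, add_zero]
  exact (gaussMeasure_Ioc_le le_rfl le_rfl).trans_lt ENNReal.ofReal_lt_top⟩

/-- The set of points of `(0, 1]` with first digit `n`. -/
def cell (n : ℕ) : Set ℝ := Ioc (1 / ((n : ℝ) + 1)) (1 / n)

lemma cell_subset {n : ℕ} (hn : 1 ≤ n) : cell n ⊆ Ioc 0 1 := by
  have hn' : (1 : ℝ) ≤ n := by exact_mod_cast hn
  refine Ioc_subset_Ioc (by positivity) ?_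
  rw [div_le_one (by linarith)]
  exact hn'

lemma mem_cell_iff {n : ℕ} (hn : 1 ≤ n) {x : ℝ} (hx : 0 < x) : x ∈ cell n ↔ digit x = n := by
  have hn' : (0 : ℝ) < n := by exact_mod_cast hn
  rw [digit, Nat.floor_eq_iff (by positivity), cell, mem_Ioc, le_div_iff₀ hn', le_div_iff₀ hx,
    div_lt_iff₀ (by positivity), div_lt_iff₀ hx, mul_comm x, mul_comm x, and_comm]

lemma gaussMeasure_cell_le {n : ℕ} (hn : 1 ≤ n) :
    gaussMeasure (cell n) ≤ ENNReal.ofReal (1 / Real.log 2 * ((n : ℝ) ^ 2)⁻¹) := by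
  have hl := log_two_pos
  have hn' : (1 : ℝ) ≤ n := by exact_mod_cast hn
  have hn0 : (0 : ℝ) < n := by linarith
  refine (gaussMeasure_Ioc_le (by positivity) ?_).trans (ENNReal.ofReal_le_ofReal ?_)
  · rw [div_le_one hn0]; exact hn'
  · have e : 1 / (Real.log 2 * (1 + 1 / ((n : ℝ) + 1))) * (1 / n - 1 / ((n : ℝ) + 1)) =
        1 / Real.log 2 * ((n : ℝ) * (n + 2))⁻¹ := by
      field_simp
      ring
    rw [e]
    gcongr
    nlinarith

lemma le_gaussMeasure_cell {n : ℕ} (hn : 1 ≤ n) :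
    ENNReal.ofReal (1 / Real.log 2 * (((n : ℝ) + 1) ^ 2)⁻¹) ≤ gaussMeasure (cell n) := by
  have hl := log_two_pos
  have hn' : (1 : ℝ) ≤ n := by exact_mod_cast hn
  have hn0 : (0 : ℝ) < n := by linarith
  refine le_trans (ENNReal.ofReal_le_ofReal (le_of_eq ?_))
    (le_gaussMeasure_Ioc (by positivity) (by positivity) ?_)
  · field_simp
    ring
  · rw [div_le_one hn0]; exact hn'

lemma measurable_primeDigit : Measurable primeDigit := by
  have h : Measurable digit := Nat.measurable_floor.comp (measurable_const.div measurable_id)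
  exact (Measurable.of_discrete (f := fun n : ℕ => if n.Prime then n else 0)).comp h

lemma measurable_primeDigit_real : Measurable fun x => (primeDigit x : ℝ) :=
  (Measurable.of_discrete (f := fun n : ℕ => (n : ℝ))).comp measurable_primeDigit

lemma lt_primeDigit_iff {K : ℝ} (hK : 0 ≤ K) (x : ℝ) :
    K < primeDigit x ↔ (digit x).Prime ∧ ⌊K⌋₊ < digit x := by
  rw [primeDigit, ← Nat.floor_lt hK]
  split_ifs with h <;> simp [h]

/-- Quantifying over all `b` bounds every partial sum of the series of cell measures, so no infinite
sum over primes is needed. -/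
lemma gaussMeasure_lt_primeDigit_le {K c : ℝ} (hK : 0 ≤ K)
    (h : ∀ b ≥ K, ∑ p ∈ Finset.Ioc ⌊K⌋₊ ⌊b⌋₊ with p.Prime, ((p : ℝ) ^ 2)⁻¹ ≤ c) :
    gaussMeasure.real {x | K < primeDigit x} ≤ 1 / Real.log 2 * c := by
  have hl := log_two_pos
  have hc : 0 ≤ c := (Finset.sum_nonneg fun p _ => by positivity).trans (h K le_rfl)
  refine ENNReal.toReal_le_of_le_ofReal (by positivity) ?_
  have hsub : {x | K < primeDigit x} ⊆ (Ioc 0 1)ᶜ ∪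
      ⋃ n : ℕ, if n.Prime ∧ ⌊K⌋₊ < n then cell n else ∅ := by
    intro x hx
    by_cases hx1 : x ∈ Ioc (0 : ℝ) 1
    · right
      rw [mem_ofPred_eq, lt_primeDigit_iff hK] at hx
      refine mem_iUnion.2 ⟨digit x, ?_⟩
      rw [if_pos hx]
      exact (mem_cell_iff hx.1.one_le hx1.1).2 rfl
    · exact Or.inl hx1
  refine (measure_mono hsub).trans ((measure_union_le _ _).trans ?_)
  rw [gaussMeasure_compl_Ioc, zero_add]
  refine (measure_iUnion_le _).trans (ENNReal.tsum_le_of_sum_range_le fun m => ?_)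
  calc ∑ n ∈ Finset.range m, gaussMeasure (if n.Prime ∧ ⌊K⌋₊ < n then cell n else ∅)
      ≤ ∑ n ∈ Finset.range m, ENNReal.ofReal
          (if n.Prime ∧ ⌊K⌋₊ < n then 1 / Real.log 2 * ((n : ℝ) ^ 2)⁻¹ else 0) := by
        refine Finset.sum_le_sum fun n _ => ?_
        split_ifs with hn
        · exact gaussMeasure_cell_le hn.1.one_le
        · simp
    _ = ENNReal.ofReal (1 / Real.log 2 *
          ∑ n ∈ Finset.range m with n.Prime ∧ ⌊K⌋₊ < n, ((n : ℝ) ^ 2)⁻¹) := by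
        rw [← ENNReal.ofReal_sum_of_nonneg (fun n _ => by positivity), ← Finset.sum_filter,
          Finset.mul_sum]
    _ ≤ ENNReal.ofReal (1 / Real.log 2 * c) := by
        refine ENNReal.ofReal_le_ofReal (mul_le_mul_of_nonneg_left ?_ (by positivity))
        refine le_trans (Finset.sum_le_sum_of_subset_of_nonneg ?_ fun p _ _ => by positivity)
          (h (max K m) (le_max_left _ _))
        intro n hn
        simp only [Finset.mem_filter, Finset.mem_range, Finset.mem_Ioc] at hn ⊢
        refine ⟨⟨hn.2.2, Nat.le_floor (le_trans ?_ (le_max_right _ _))⟩, hn.2.1⟩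
        exact_mod_cast hn.1.le

lemma le_gaussMeasure_lt_primeDigit {K : ℝ} (hK : 0 ≤ K) (b : ℝ) :
    ∑ p ∈ Finset.Ioc ⌊K⌋₊ ⌊b⌋₊ with p.Prime, 1 / Real.log 2 * (((p : ℝ) + 1) ^ 2)⁻¹ ≤
      gaussMeasure.real {x | K < primeDigit x} := by
  have hl := log_two_pos
  set F := {p ∈ Finset.Ioc ⌊K⌋₊ ⌊b⌋₊ | p.Prime} with hF
  have hprime : ∀ p ∈ F, 1 ≤ p := fun p hp => (Finset.mem_filter.1 hp).2.one_le
  have hdisj : (F : Set ℕ).PairwiseDisjoint cell := by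
    intro p hp q hq hpq
    refine disjoint_left.2 fun x hxp hxq => hpq ?_
    have hx := (cell_subset (hprime p hp) hxp).1
    rw [← (mem_cell_iff (hprime p hp) hx).1 hxp, ← (mem_cell_iff (hprime q hq) hx).1 hxq]
  have hsub : ⋃ p ∈ F, cell p ⊆ {x | K < primeDigit x} := by
    refine iUnion₂_subset fun p hp x hx => ?_
    have h0 := (cell_subset (hprime p hp) hx).1
    have hd := (mem_cell_iff (hprime p hp) h0).1 hx
    rw [mem_ofPred_eq, lt_primeDigit_iff hK, hd]
    obtain ⟨h1, h2⟩ := Finset.mem_filter.1 hp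
    exact ⟨h2, (Finset.mem_Ioc.1 h1).1⟩
  refine le_trans ?_ (measureReal_mono hsub)
  rw [measureReal_biUnion_finset hdisj fun p _ => measurableSet_Ioc]
  refine Finset.sum_le_sum fun p hp => ?_
  exact (ENNReal.ofReal_le_iff_le_toReal (measure_ne_top _ _)).1
    (le_gaussMeasure_cell (hprime p hp))

/-- The asymptotic size of the tail of the prime digit. -/
noncomputable def tailBound (K : ℝ) : ℝ := 1 / Real.log 2 * (1 / (K * Real.log K))

lemma tailBound_pos {K : ℝ} (hK : 1 < K) : 0 < tailBound K := by
  have := log_two_pos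
  have := Real.log_pos hK
  unfold tailBound
  positivity

lemma gaussMeasure_lt_primeDigit_isEquivalent :
    (fun K : ℝ => gaussMeasure.real {x | K < primeDigit x}) ~[atTop] tailBound := by
  have hl := log_two_pos
  rw [IsEquivalent, isLittleO_iff]
  intro ε' hε'
  -- The lower bound loses `1 - ε` twice, from the prime sum and from replacing `(p + 1)²` by `p²`;
  -- the latter needs `p ≥ 2 / ε`.
  set ε := min (ε' / 2) (1 / 2) with hεd
  have hε : 0 < ε := by positivity
  have hε1 : ε < 1 := (min_le_right _ _).trans_lt (by norm_num)
  have hεε' : 2 * ε ≤ ε' := by linarith [min_le_left (ε' / 2) (1 / 2)]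
  filter_upwards [eventually_sum_inv_sq_le hε, eventually_le_sum_inv_sq hε hε1,
    eventually_gt_atTop 1, eventually_ge_atTop (2 / ε)] with K hup hlo hK hKε
  have hpos := tailBound_pos hK
  have hlog := Real.log_pos hK
  have hK0 : 0 < K := by linarith
  rw [Pi.sub_apply, Real.norm_of_nonneg hpos.le, Real.norm_eq_abs, abs_le]
  obtain ⟨b, hb, hblo⟩ := hlo
  have h1 := gaussMeasure_lt_primeDigit_le hK0.le hup
  have h2 := le_gaussMeasure_lt_primeDigit hK0.le b
  have h3 : (1 - ε) * (1 / Real.log 2 *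
      ∑ p ∈ Finset.Ioc ⌊K⌋₊ ⌊b⌋₊ with p.Prime, ((p : ℝ) ^ 2)⁻¹) ≤
      ∑ p ∈ Finset.Ioc ⌊K⌋₊ ⌊b⌋₊ with p.Prime, 1 / Real.log 2 * (((p : ℝ) + 1) ^ 2)⁻¹ := by
    rw [Finset.mul_sum, Finset.mul_sum]
    refine Finset.sum_le_sum fun p hp => ?_
    have hp' : K < p := Nat.lt_of_floor_lt (Finset.mem_Ioc.1 (Finset.mem_filter.1 hp).1).1
    have hp0 : (0 : ℝ) < p := by linarith
    rw [mul_left_comm]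
    refine mul_le_mul_of_nonneg_left ?_ (by positivity)
    rw [← div_eq_mul_inv, div_le_iff₀ (by positivity), ← div_eq_inv_mul,
      le_div_iff₀ (by positivity)]
    have h4 : 2 ≤ ε * p := by
      rw [div_le_iff₀ hε] at hKε
      nlinarith
    nlinarith [mul_le_mul_of_nonneg_right h4 hp0.le]
  have e1 : 1 / Real.log 2 * ((1 + ε) / (K * Real.log K)) = (1 + ε) * tailBound K := by
    unfold tailBound; ring
  have e2 : (1 - ε) * (1 / Real.log 2 * ((1 - ε) / (K * Real.log K))) =
      (1 - ε) * (1 - ε) * tailBound K := by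
    unfold tailBound; ring
  have h5 := mul_le_mul_of_nonneg_left (mul_le_mul_of_nonneg_left hblo
    (show 0 ≤ 1 / Real.log 2 by positivity)) (show 0 ≤ 1 - ε by linarith)
  rw [e1] at h1
  rw [e2] at h5
  have h6 := mul_le_mul_of_nonneg_right hεε' hpos.le
  constructor
  · nlinarith [mul_pos (mul_pos hε hε) hpos]
  · nlinarith [mul_pos hε hpos]

lemma gaussMeasure_primeDigit_eq_le {K : ℝ} (hK : 0 < K) :
    gaussMeasure.real {x | K = primeDigit x} ≤ 1 / Real.log 2 * (K ^ 2)⁻¹ := by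
  have hl := log_two_pos
  refine ENNReal.toReal_le_of_le_ofReal (by positivity) ?_
  by_cases h : ∃ n : ℕ, (n : ℝ) = K
  · obtain ⟨n, rfl⟩ := h
    have hn : 1 ≤ n := by
      have : 0 < n := by exact_mod_cast hK
      omega
    refine le_trans (measure_mono (t := (Ioc 0 1)ᶜ ∪ cell n) fun x hx => ?_)
      ((measure_union_le _ _).trans ?_)
    · by_cases hx1 : x ∈ Ioc (0 : ℝ) 1
      · right
        rw [mem_cell_iff hn hx1.1]
        have hx' : n = primeDigit x := by exact_mod_cast (show (n : ℝ) = primeDigit x from hx)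
        rw [primeDigit] at hx'
        split_ifs at hx' with hp
        · exact hx'.symm
        · omega
      · exact Or.inl hx1
    · rw [gaussMeasure_compl_Ioc, zero_add]
      exact gaussMeasure_cell_le hn
  · have : {x | K = primeDigit x} = ∅ := by
      refine eq_empty_of_forall_notMem fun x hx => h ⟨primeDigit x, Eq.symm hx⟩
    rw [this, measure_empty]
    exact zero_le

/-- The tail of the distribution of the prime digit. -/
lemma gaussMeasure_le_primeDigit_isEquivalent :
    (fun K : ℝ => gaussMeasure.real {x | K ≤ primeDigit x}) ~[atTop] tailBound := by
  have hl := log_two_pos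
  -- Passing from `<` to `≤` adds at most one cell, of measure `O(K⁻²)`, which is negligible against
  -- `1/(K log K)`.
  have hO : (fun K : ℝ => gaussMeasure.real {x | K = primeDigit x}) =o[atTop] tailBound := by
    have h1 : (fun K : ℝ => gaussMeasure.real {x | K = primeDigit x}) =O[atTop]
        fun K => 1 / Real.log 2 * (K ^ 2)⁻¹ := by
      refine IsBigO.of_bound 1 ?_
      filter_upwards [eventually_gt_atTop 0] with K hK
      rw [one_mul, Real.norm_of_nonneg measureReal_nonneg, Real.norm_of_nonneg (by positivity)]
      exact gaussMeasure_primeDigit_eq_le hK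
    refine h1.trans_isLittleO ((isLittleO_iff_tendsto' ?_).2
      (Real.isLittleO_log_id_atTop.tendsto_div_nhds_zero.congr' ?_))
    · filter_upwards [eventually_gt_atTop 1] with K hK h
      exact absurd h (tailBound_pos hK).ne'
    · filter_upwards [eventually_gt_atTop 1] with K hK
      have := Real.log_pos hK
      simp only [tailBound, id]
      field_simp
  refine (gaussMeasure_lt_primeDigit_isEquivalent.add_isLittleO hO).congr_left
    (Eventually.of_forall fun K => ?_)
  simp only [Pi.add_apply]
  rw [← measureReal_union _ (measurableSet_eq_fun measurable_const measurable_primeDigit_real)]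
  · congr 1
    ext x
    exact (le_iff_lt_or_eq (a := K) (b := (primeDigit x : ℝ))).symm
  · exact disjoint_left.2 fun x (h : K < _) (h' : K = _) => h.ne h'

end GaussMeasure

/-! ### The truncated mean and non-integrability -/

/-- Asymptotically equivalent functions have asymptotically equivalent divergent integrals. -/
lemma isEquivalent_integral {f g G : ℝ → ℝ} {a : ℝ} (hfg : f ~[atTop] g)
    (hf : ∀ b, IntervalIntegrable f volume a b) (hg : ∀ᶠ t in atTop, 0 ≤ g t)
    (hG : ∀ᶠ t in atTop, HasDerivAt G (g t) t) (hGt : Tendsto G atTop atTop) :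
    (fun b => ∫ t in a..b, f t) ~[atTop] G := by
  rw [IsEquivalent, isLittleO_iff]
  intro ε hε
  obtain ⟨c, hc⟩ := eventually_atTop.1 (((hfg.isLittleO.bound (show 0 < ε / 2 by positivity)).and
    (hg.and hG)).and (hGt.eventually_ge_atTop 0))
  -- The discrepancy accumulated up to `c` is a constant, absorbed once `G b ≥ A / (ε / 2)`.
  set A := ‖(∫ t in a..c, f t) - G c‖ with hA
  filter_upwards [eventually_ge_atTop c, hGt.eventually_ge_atTop (A / (ε / 2))] with b hb hGb
  have hderiv : ∀ t ∈ uIcc c b, HasDerivAt G (g t) t := fun t ht => by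
    rw [uIcc_of_le hb] at ht
    exact (hc t ht.1).1.2.2
  have hgi : IntervalIntegrable g volume c b := by
    refine intervalIntegral.intervalIntegrable_deriv_of_nonneg (g := G)
      (fun t ht => (hderiv t ht).continuousAt.continuousWithinAt)
      (fun t ht => hderiv t (Ioo_subset_Icc_self ht)) fun t ht => ?_
    rw [min_eq_left hb] at ht
    exact (hc t ht.1.le).1.2.1
  have hfi : IntervalIntegrable f volume c b := (hf c).symm.trans (hf b)
  have e1 : ∫ t in c..b, g t = G b - G c :=
    intervalIntegral.integral_eq_sub_of_hasDerivAt hderiv hgi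
  have e2 : (∫ t in a..b, f t) - G b =
      ((∫ t in a..c, f t) - G c) + ∫ t in c..b, (f t - g t) := by
    rw [intervalIntegral.integral_sub hfi hgi, e1,
      ← intervalIntegral.integral_add_adjacent_intervals (hf c) hfi]
    ring
  have e3 : ‖∫ t in c..b, (f t - g t)‖ ≤ ε / 2 * (G b - G c) := by
    rw [← e1, ← intervalIntegral.integral_const_mul]
    refine intervalIntegral.norm_integral_le_of_norm_le hb (ae_of_all _ fun t ht => ?_)
      (hgi.const_mul _)
    have h := hc t ht.1.le
    have h1 := h.1.1
    rwa [Real.norm_of_nonneg h.1.2.1] at h1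
  have hGc : 0 ≤ G c := (hc c le_rfl).2
  have hGb0 : 0 ≤ G b := (hc b hb).2
  rw [div_le_iff₀ (by positivity)] at hGb
  rw [Pi.sub_apply, e2, Real.norm_of_nonneg hGb0]
  refine (norm_add_le _ _).trans ?_
  nlinarith

lemma tendsto_log_log : Tendsto (fun t => Real.log (Real.log t)) atTop atTop :=
  Real.tendsto_log_atTop.comp Real.tendsto_log_atTop

lemma tendsto_log_log_div : Tendsto (fun t => Real.log (Real.log t) / Real.log 2) atTop atTop :=
  tendsto_log_log.atTop_div_const log_two_pos

lemma hasDerivAt_log_log {t : ℝ} (ht : 1 < t) :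
    HasDerivAt (fun t => Real.log (Real.log t) / Real.log 2) (tailBound t) t := by
  have h0 : t ≠ 0 := by positivity
  have hl := Real.log_pos ht
  convert! ((Real.hasDerivAt_log h0).log hl.ne').div_const (Real.log 2) using 1
  unfold tailBound
  field_simp

lemma integrable_min_primeDigit (t : ℝ) :
    Integrable (fun x => min (primeDigit x : ℝ) t) gaussMeasure := by
  refine Integrable.of_bound
    (measurable_primeDigit_real.min measurable_const).aestronglyMeasurable |t|
    (ae_of_all _ fun x => ?_)
  rw [Real.norm_eq_abs, abs_le]
  have : (0 : ℝ) ≤ primeDigit x := Nat.cast_nonneg _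
  exact ⟨le_min (by linarith [abs_nonneg t]) (neg_abs_le t), (min_le_right _ _).trans (le_abs_self t)⟩

/-- Layer-cake formula: for `t ≤ N` the truncation does not affect the event of exceeding `t`. -/
lemma truncatedMean_eq_integral {N : ℝ} (hN : 0 ≤ N) :
    truncatedMean N = ∫ t in (0 : ℝ)..N, gaussMeasure.real {x | t ≤ primeDigit x} := by
  rw [truncatedMean, (integrable_min_primeDigit N).integral_eq_integral_Ioc_meas_le
    (ae_of_all _ fun x => le_min (Nat.cast_nonneg _) hN) (ae_of_all _ fun x => min_le_right _ _),
    intervalIntegral.integral_of_le hN]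
  refine setIntegral_congr_fun measurableSet_Ioc fun t ht => ?_
  simp only [le_min_iff, ht.2, and_true]

lemma truncatedMean_isEquivalent :
    truncatedMean ~[atTop] fun N => Real.log (Real.log N) / Real.log 2 := by
  have hanti : Antitone fun t : ℝ => gaussMeasure.real {x | t ≤ primeDigit x} :=
    fun s t hst => measureReal_mono fun x (hx : t ≤ _) => hst.trans hx
  refine (isEquivalent_integral (a := 0) gaussMeasure_le_primeDigit_isEquivalent
    (fun b => hanti.intervalIntegrable) ?_ ?_ tendsto_log_log_div).congr_left ?_
  · filter_upwards [eventually_gt_atTop 1] with t ht using (tailBound_pos ht).le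
  · filter_upwards [eventually_gt_atTop 1] with t ht using hasDerivAt_log_log ht
  · filter_upwards [eventually_ge_atTop 0] with N hN using (truncatedMean_eq_integral hN).symm

/-- The integral would bound all truncated means, which tend to infinity. -/
lemma not_integrable_primeDigit :
    ¬ Integrable (fun x => (primeDigit x : ℝ)) gaussMeasure := by
  intro h
  have h1 := truncatedMean_isEquivalent.symm.tendsto_atTop tendsto_log_log_div
  obtain ⟨N, hN⟩ := (h1.eventually_gt_atTop (∫ x, (primeDigit x : ℝ) ∂gaussMeasure)).exists
  exact hN.not_ge (integral_mono (integrable_min_primeDigit N) h fun x => min_le_left _ _)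

lemma lintegral_primeDigit : ∫⁻ x, (primeDigit x : ENNReal) ∂gaussMeasure = ⊤ := by
  by_contra hne
  refine not_integrable_primeDigit ⟨measurable_primeDigit_real.aestronglyMeasurable, ?_⟩
  rw [hasFiniteIntegral_iff_ofReal (ae_of_all _ fun x => Nat.cast_nonneg _)]
  simpa using lt_top_iff_ne_top.2 hne

/-! ### Asymptotic inversion -/

lemma aPrime_isEquivalent :
    aPrime ~[atTop] fun N => Real.log 2 * (N / Real.log (Real.log N)) := by
  refine (IsEquivalent.div (IsEquivalent.refl (u := fun N : ℝ => N))
    truncatedMean_isEquivalent).congr_right (Eventually.of_forall fun N => ?_)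
  rw [Pi.div_apply, div_div_eq_mul_div]
  ring

lemma isLittleO_log_log : (fun t => Real.log (Real.log t)) =o[atTop] Real.log :=
  Real.isLittleO_log_id_atTop.comp_tendsto Real.tendsto_log_atTop

/-- If `log u` is asymptotically equivalent to `log t`, then so are the iterated logarithms. -/
lemma log_log_isEquivalent {u : ℝ → ℝ}
    (hu : (fun t => Real.log (u t)) ~[atTop] Real.log) :
    (fun t => Real.log (Real.log (u t))) ~[atTop] fun t => Real.log (Real.log t) :=
  hu.log Real.tendsto_log_atTop

/-- The factor `log log t / log 2` adds only a triple logarithm and a constant to `log t`. -/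
lemma log_bPrime_isEquivalent : (fun t => Real.log (bPrime t)) ~[atTop] Real.log := by
  have h1 : (fun t => Real.log (Real.log (Real.log t)) - Real.log (Real.log 2)) =o[atTop]
      Real.log := by
    refine IsLittleO.sub ?_ Real.isLittleO_const_log_atTop
    exact (isLittleO_log_log.comp_tendsto Real.tendsto_log_atTop).trans isLittleO_log_log
  refine (IsEquivalent.refl.add_isLittleO h1).congr_left ?_
  filter_upwards [eventually_gt_atTop 0, tendsto_log_log.eventually_gt_atTop 0] with t ht hlt
  rw [bPrime, Real.log_div (by positivity) log_two_pos.ne', Real.log_mul ht.ne' hlt.ne',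
    Pi.add_apply]
  ring

lemma tendsto_bPrime : Tendsto bPrime atTop atTop :=
  (tendsto_id.atTop_mul_atTop₀ tendsto_log_log).atTop_div_const log_two_pos

lemma log_aux_isEquivalent :
    (fun t => Real.log (Real.log 2 * (t / Real.log (Real.log t)))) ~[atTop] Real.log := by
  have h1 : (fun t => Real.log (Real.log 2) - Real.log (Real.log (Real.log t))) =o[atTop]
      Real.log := by
    refine IsLittleO.sub Real.isLittleO_const_log_atTop ?_
    exact (isLittleO_log_log.comp_tendsto Real.tendsto_log_atTop).trans isLittleO_log_log
  refine (IsEquivalent.refl.add_isLittleO h1).congr_left ?_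
  filter_upwards [eventually_gt_atTop 0, tendsto_log_log.eventually_gt_atTop 0] with t ht hlt
  rw [Real.log_mul log_two_pos.ne' (by positivity), Real.log_div ht.ne' hlt.ne', Pi.add_apply]
  ring

lemma tendsto_div_log_log :
    Tendsto (fun t => Real.log 2 * (t / Real.log (Real.log t))) atTop atTop := by
  refine Tendsto.const_mul_atTop log_two_pos ?_
  have h : (fun t => Real.log (Real.log t)) =o[atTop] fun t : ℝ => t :=
    isLittleO_log_log.trans Real.isLittleO_log_id_atTop
  have h2 : Tendsto (fun t => Real.log (Real.log t) / t) atTop (𝓝[>] 0) := by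
    refine tendsto_nhdsWithin_iff.2 ⟨h.tendsto_div_nhds_zero, ?_⟩
    filter_upwards [eventually_gt_atTop 0, tendsto_log_log.eventually_gt_atTop 0] with t ht hlt
    exact div_pos hlt ht
  refine h2.inv_tendsto_nhdsGT_zero.congr fun t => ?_
  rw [Pi.inv_apply, inv_div]

lemma tendsto_aPrime : Tendsto aPrime atTop atTop :=
  aPrime_isEquivalent.symm.tendsto_atTop tendsto_div_log_log

/-- Both functions change `log log` of their argument only up to equivalence, so in each composition
the factors `log log t` and `log 2` cancel. -/
lemma asymptoticallyInverse_aPrime_bPrime : AsymptoticallyInverse aPrime bPrime := by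
  have hl := log_two_pos
  refine ⟨tendsto_aPrime, tendsto_bPrime, ?_, ?_⟩
  · have h1 : (fun t => aPrime (bPrime t)) ~[atTop]
        fun t => Real.log 2 * (bPrime t / Real.log (Real.log (bPrime t))) :=
      aPrime_isEquivalent.comp_tendsto tendsto_bPrime
    have h2 : (fun t => Real.log 2 * (bPrime t / Real.log (Real.log (bPrime t)))) ~[atTop]
        fun t => Real.log 2 * (bPrime t / Real.log (Real.log t)) :=
      IsEquivalent.refl.mul (IsEquivalent.refl.div (log_log_isEquivalent log_bPrime_isEquivalent))
    refine (h1.trans h2).congr_right ?_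
    filter_upwards [tendsto_log_log.eventually_gt_atTop 0] with t hlt
    rw [bPrime]
    field_simp
  · have h1 : (fun t => Real.log (aPrime t)) ~[atTop] Real.log :=
      (aPrime_isEquivalent.log tendsto_div_log_log).trans log_aux_isEquivalent
    have h2 : (fun t => bPrime (aPrime t)) ~[atTop]
        fun t => Real.log 2 * (t / Real.log (Real.log t)) * Real.log (Real.log t) / Real.log 2 :=
      (aPrime_isEquivalent.mul (log_log_isEquivalent h1)).div IsEquivalent.refl
    refine h2.congr_right ?_
    filter_upwards [tendsto_log_log.eventually_gt_atTop 0] with t hlt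
    field_simp

end PrimeDigit

open PrimeDigit in
theorem mainTheorem9 :
    ((fun K : ℝ => gaussMeasure.real {x | K ≤ (primeDigit x : ℝ)})
        ~[atTop] fun K : ℝ => 1 / Real.log 2 * (1 / (K * Real.log K))) ∧
    (¬ Integrable (fun x => (primeDigit x : ℝ)) gaussMeasure ∧
      ∫⁻ x, (primeDigit x : ENNReal) ∂gaussMeasure = ⊤) ∧
    (truncatedMean ~[atTop] fun N : ℝ => Real.log (Real.log N) / Real.log 2) ∧
    (aPrime ~[atTop] fun N : ℝ => Real.log 2 * (N / Real.log (Real.log N))) ∧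
    AsymptoticallyInverse aPrime bPrime := by
  exact ⟨gaussMeasure_le_primeDigit_isEquivalent,
    ⟨not_integrable_primeDigit, lintegral_primeDigit⟩, truncatedMean_isEquivalent,
    aPrime_isEquivalent, asymptoticallyInverse_aPrime_bPrime⟩
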